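/- Let $\{\mathbb{Z}_n(t),\ t\in\mathbb{R}\}$, $n\in\mathbb{N}$, be real-valued stochastic processes (the $n$-th one defined on a probability space $\Omega_n$) such that all sample paths of $\mathbb{Z}_n$ are right-continuous, of bounded (finite total) variation on $\mathbb{R}$, and satisfy $\lim_{|t|\to\infty}\mathbb{Z}_n(t)=0$. Assume that $\mathbb{Z}_n$ converges weakly in $\ell^\infty(\mathbb{R})$, in the sense of Hoffmann-Jørgensen, to a Gaussian process $\mathbb{Z}$; that is, $\mathbb{Z}$ is a Borel measurable map from a probability space into $\ell^\infty(\mathbb{R})$ with the supremum norm, all of its finite-dimensional distributions are Gaussian, and $\mathbb{E}^*H(\mathbb{Z}_n)\to\mathbb{E}H(\mathbb{Z})$ as $n\to\infty$ for every bounded continuous $H:\ell^\infty(\mathbb{R})\to\mathbb{R}$, where $\mathbb{E}^*$ denotes outer expectation. Then for every right-continuous function $g:\mathbb{R}\to\mathbb{R}$ of bounded variation on $\mathbb{R}$, the Lebesgue–Stieltjes integral $\overline{\mathbb{Z}}_n(g)=\int g\,\mathrm{d}\mathbb{Z}_n$ is well defined (for every $n$ and every sample path of $\mathbb{Z}_n$,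 $g$ is integrable with respect to the total variation of the finite signed measure induced by the path, and $\overline{\mathbb{Z}}_n(g)$ is a random variable), and there exist $m\in\mathbb{R}$ and $v\ge 0$ such that $\overline{\mathbb{Z}}_n(g)$ converges in distribution, as $n\to\infty$, to the normal distribution $N(m,v)$ (the point mass at $m$ if $v=0$). -/

import Mathlib

open MeasureTheory ProbabilityTheory Filter Set
open scoped Topology ENNReal lp BoundedContinuousFunction

/-- The outer expectation `E^* T = inf {E U : U ≥ T, U measurable and integrable}` of a
(possibly non-measurable) bounded function `T` on a probability space. -/
noncomputable def outerExpectation {Ω : Type*} [MeasurableSpace Ω] (P : Measure Ω)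
    (T : Ω → ℝ) : ℝ :=
  sInf {r : ℝ | ∃ U : Ω → ℝ, Measurable U ∧ Integrable U P ∧ (∀ ω, T ω ≤ U ω) ∧ r = ∫ ω, U ω ∂P}

/-- Weak convergence in the sense of Hoffmann-Jørgensen of arbitrary maps `X n : Ω n → S`, defined
on possibly different probability spaces, to a Borel measurable map `Z : Ω' → S`:
`E^* H (X n) → E H (Z)` for every bounded continuous `H : S → ℝ`. -/
structure TendstoHoffmannJorgensen {S : Type*} [TopologicalSpace S]
    {Ω : ℕ → Type*} [∀ n, MeasurableSpace (Ω n)] {Ω' : Type*} [MeasurableSpace Ω']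
    (X : ∀ n, Ω n → S) (P : ∀ n, Measure (Ω n)) (Z : Ω' → S) (P' : Measure Ω') : Prop where
  borel_measurable_limit : Measurable[_, borel S] Z
  tendsto_outerExpectation : ∀ H : S →ᵇ ℝ,
    Tendsto (fun n ↦ outerExpectation (P n) (fun ω ↦ H (X n ω))) atTop
      (𝓝 (∫ ω, H (Z ω) ∂P'))

/-- The Lebesgue-Stieltjes integral `∫ g dF` of `g` against the finite signed measure determined by
a function `F : ℝ → ℝ` of bounded variation (for right-continuous `F` this is the measure with
`μ (a, b] = F b - F a`). -/
noncomputable def lebesgueStieltjesIntegral {F : ℝ → ℝ} (hF : BoundedVariationOn F univ)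
    (g : ℝ → ℝ) : ℝ :=
  hF.vectorMeasure.integral g (ContinuousLinearMap.lsmul ℝ ℝ)

/-!
The integral `∫ g dF` is the limit of the Riemann-Stieltjes sums
`L_k F = ∑ g(a_{i+1}) (F(a_{i+1}) - F(a_i))` over finer and finer grids: `L_k F` is the integral
against `dF` of a step function, and right-continuity of `g` makes these step functions converge
boundedly and everywhere to `g` (`tendsto_sum_lebesgueStieltjesIntegral`). In particular the integral
is measurable in the path `F`. After summation by parts the variation falls on `g`, so the `L_k` are
uniformly bounded functionals for the supremum norm (`norm_stieltjesSum_le`).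

Since `F ↦ ∫ g dF` makes no sense on all of `ℓ^∞(ℝ)`, it is extended: a weak-* limit point `Λ` of
the `L_k` is a continuous functional on `ℓ^∞(ℝ)` that agrees with `lim L_k` wherever this limit
exists (`exists_clm_tendsto_of_bounded`). Hence `Λ(Z_n) = ∫ g dZ_n`, and the continuous mapping
theorem gives `∫ g dZ_n → Λ(Z)` in distribution
(`TendstoHoffmannJorgensen.tendstoInDistribution_comp`).

It remains to see that `Λ(Z)` is Gaussian. The set where `L_k → Λ` is closed and contains the paths
of all the `Z_n`, hence it contains almost every path of `Z`
(`TendstoHoffmannJorgensen.ae_mem_of_isClosed`). So `Λ(Z)` is almost surely the limit of the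
`L_k(Z)`, which are Gaussian as finite linear combinations of values of `Z`, and such limits are
Gaussian (`exists_map_eq_gaussianReal_of_tendsto_ae`).
-/

/-! ### Limits of Gaussian laws -/

/-- The functions `t ↦ exp (i t m_k)` are the characteristic functions of the point masses at
`m_k`. By Lévy's theorem these point masses are tight, so the sequence `m` is
bounded and has a convergent subsequence. -/
theorem exists_subseq_of_tendsto_exp_mul_I {m : ℕ → ℝ} {ψ : ℝ → ℂ} (hψ : ContinuousAt ψ 0)
    (h : ∀ t : ℝ, Tendsto (fun k ↦ Complex.exp (t * m k * Complex.I)) atTop (𝓝 (ψ t))) :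
    ∃ (a : ℝ) (φ : ℕ → ℕ), StrictMono φ ∧ Tendsto (m ∘ φ) atTop (𝓝 a) := by
  have htight : IsTightMeasureSet (range fun k ↦ Measure.dirac (m k)) := by
    refine isTightMeasureSet_of_tendsto_charFun hψ fun t ↦ ?_
    simpa [charFun_dirac, mul_comm] using h t
  rw [isTightMeasureSet_iff_exists_isCompact_measure_compl_le] at htight
  obtain ⟨K, hK, hKm⟩ := htight (1 / 2) (by simp)
  have hmem : ∀ k, m k ∈ K := by
    intro k
    by_contra hk
    have h1 := hKm _ ⟨k, rfl⟩
    rw [Measure.dirac_apply' _ hK.isClosed.measurableSet.compl] at h1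
    simp [hk] at h1
  obtain ⟨a, -, φ, hφ, ha⟩ := hK.tendsto_subseq hmem
  exact ⟨a, φ, hφ, ha⟩

/-- A limit in distribution of real Gaussian laws is Gaussian. The moduli of the characteristic
functions bound the variances; along a subsequence where the variances converge, the phases
`exp (i t m_k)` converge, and this bounds the means. -/
theorem exists_eq_gaussianReal_of_tendsto_charFun {m : ℕ → ℝ} {v : ℕ → NNReal} {ν : Measure ℝ}
    [IsProbabilityMeasure ν]
    (h : ∀ t, Tendsto (fun k ↦ charFun (gaussianReal (m k) (v k)) t) atTop (𝓝 (charFun ν t))) :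
    ∃ (a : ℝ) (b : NNReal), ν = gaussianReal a b := by
  -- Since `charFun ν` is continuous with value `1` at `0`, it is away from `0` at some `t ≠ 0`.
  have hcont : Continuous (charFun ν) := by fun_prop
  obtain ⟨t, ht0, ht⟩ : ∃ t : ℝ, t ≠ 0 ∧ 1 / 2 < ‖charFun ν t‖ := by
    have h1 : ∀ᶠ t in 𝓝[≠] (0 : ℝ), 1 / 2 < ‖charFun ν t‖ := by
      refine ((hcont.norm.tendsto 0).mono_left nhdsWithin_le_nhds).eventually_const_lt ?_
      simp only [charFun_zero, probReal_univ]; norm_num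
    obtain ⟨t, h2, h3⟩ := (h1.and self_mem_nhdsWithin).exists
    exact ⟨t, h3, h2⟩
  -- The modulus `exp (-v_k t² / 2)` eventually exceeds `1 / 2`, so `v_k` is bounded.
  have hv : ∀ᶠ k in atTop, v k ∈ Icc 0 (Real.toNNReal (2 * Real.log 2 / t ^ 2)) := by
    filter_upwards [(h t).norm.eventually_const_lt ht] with k hk
    refine ⟨zero_le, ?_⟩
    rw [charFun_gaussianReal, Complex.norm_exp] at hk
    have hre : ((t * m k * Complex.I - v k * t ^ 2 / 2 : ℂ)).re = -(v k * t ^ 2 / 2) := by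
      have : (t * m k * Complex.I - v k * t ^ 2 / 2 : ℂ)
          = ((-(v k * t ^ 2 / 2) : ℝ) : ℂ) + ((t * m k : ℝ) : ℂ) * Complex.I := by
        push_cast; ring
      rw [this, Complex.add_re, Complex.ofReal_re, Complex.re_ofReal_mul, Complex.I_re]; ring
    rw [hre] at hk
    have h4 := Real.log_lt_log (by norm_num) hk
    rw [Real.log_exp, one_div, Real.log_inv] at h4
    apply NNReal.le_toNNReal_of_coe_le
    rw [le_div_iff₀ (by positivity)]
    linarith
  obtain ⟨b, -, φ, hφ, hb⟩ := isCompact_Icc.tendsto_subseq' hv.frequently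
  have hb' (t : ℝ) : Tendsto (fun k ↦ Complex.exp (v (φ k) * t ^ 2 / 2)) atTop
      (𝓝 (Complex.exp (b * t ^ 2 / 2))) := by
    have h5 : Tendsto (fun k ↦ ((v (φ k) : ℝ) : ℂ)) atTop (𝓝 ((b : ℝ) : ℂ)) :=
      ((Complex.continuous_ofReal.comp NNReal.continuous_coe).tendsto b).comp hb
    exact (Complex.continuous_exp.tendsto _).comp ((h5.mul_const _).div_const _)
  have hm (t : ℝ) : Tendsto (fun k ↦ Complex.exp (t * m (φ k) * Complex.I)) atTop
      (𝓝 (charFun ν t * Complex.exp (b * t ^ 2 / 2))) := by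
    refine (((h t).comp hφ.tendsto_atTop).mul (hb' t)).congr fun k ↦ ?_
    simp only [Function.comp, charFun_gaussianReal, ← Complex.exp_add]
    congr 1; ring
  obtain ⟨a, χ, hχ, ha⟩ := exists_subseq_of_tendsto_exp_mul_I (m := m ∘ φ)
    (by fun_prop) hm
  refine ⟨a, b, Measure.ext_of_charFun (funext fun t ↦ ?_)⟩
  have h6 : Tendsto (fun k ↦ Complex.exp (t * m (φ (χ k)) * Complex.I)) atTop
      (𝓝 (Complex.exp (t * a * Complex.I))) := by
    have h7 : Tendsto (fun k ↦ ((m (φ (χ k)) : ℝ) : ℂ)) atTop (𝓝 (a : ℂ)) :=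
      (Complex.continuous_ofReal.tendsto a).comp ha
    exact (Complex.continuous_exp.tendsto _).comp ((h7.const_mul _).mul_const _)
  have h8 := tendsto_nhds_unique ((hm t).comp hχ.tendsto_atTop) h6
  rw [charFun_gaussianReal, Complex.exp_sub, ← h8, mul_div_cancel_right₀ _ (Complex.exp_ne_zero _)]

theorem exists_map_eq_gaussianReal_of_tendsto_ae {Ω : Type*} [MeasurableSpace Ω] {P : Measure Ω}
    [IsProbabilityMeasure P] {X : ℕ → Ω → ℝ} {Y : Ω → ℝ} (hX : ∀ k, HasGaussianLaw (X k) P)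
    (hY : AEMeasurable Y P) (hXY : ∀ᵐ ω ∂P, Tendsto (fun k ↦ X k ω) atTop (𝓝 (Y ω))) :
    ∃ (m : ℝ) (v : NNReal), P.map Y = gaussianReal m v := by
  have : IsProbabilityMeasure (P.map Y) := Measure.isProbabilityMeasure_map hY
  have h := (tendstoInDistribution_of_ae_tendsto (fun k ↦ (hX k).aemeasurable) hY hXY).tendsto
  have h' := ProbabilityMeasure.tendsto_iff_tendsto_charFun.1 h
  refine exists_eq_gaussianReal_of_tendsto_charFun (m := fun k ↦ P[X k])
    (v := fun k ↦ Var[X k; P].toNNReal) fun t ↦ ?_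
  simpa only [ProbabilityMeasure.coe_mk, (hX _).map_eq_gaussianReal] using h' t

/-! ### Pointwise limits of bounded functionals -/

/-- A uniformly bounded sequence of functionals has one functional `Λ`, defined on all of `E`, that
is its pointwise limit wherever the sequence converges. By Banach-Alaoglu, `Λ` may be taken to be
the weak-* limit along a nonprincipal ultrafilter. -/
theorem exists_clm_tendsto_of_bounded {E : Type*} [NormedAddCommGroup E] [NormedSpace ℝ E]
    {L : ℕ → E →L[ℝ] ℝ} {C : ℝ} (hL : ∀ k, ‖L k‖ ≤ C) :
    ∃ Λ : E →L[ℝ] ℝ, ∀ x y, Tendsto (fun k ↦ L k x) atTop (𝓝 y) →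
      Tendsto (fun k ↦ L k x) atTop (𝓝 (Λ x)) := by
  let T : ℕ → WeakDual ℝ E := fun k ↦ StrongDual.toWeakDual (L k)
  have hK := WeakDual.isCompact_closedBall (𝕜 := ℝ) (E := E) 0 C
  have hmem : ∀ k, T k ∈ WeakDual.toStrongDual ⁻¹' Metric.closedBall (0 : StrongDual ℝ E) C := by
    intro k
    rw [mem_preimage, mem_closedBall_zero_iff]
    exact hL k
  obtain ⟨Λ, -, hΛ⟩ := hK.ultrafilter_le_nhds ((hyperfilter ℕ).map T)
    (by simp only [le_principal_iff, Ultrafilter.mem_coe, Ultrafilter.mem_map]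
        exact Filter.univ_mem' hmem)
  refine ⟨WeakDual.toStrongDual Λ, fun x y hxy ↦ ?_⟩
  have h1 : Tendsto (fun k ↦ T k x) (hyperfilter ℕ) (𝓝 (Λ x)) :=
    ((WeakDual.eval_continuous x).tendsto Λ).comp hΛ
  have h2 : Tendsto (fun k ↦ T k x) (hyperfilter ℕ) (𝓝 y) :=
    hxy.mono_left Nat.hyperfilter_le_atTop
  have h3 : WeakDual.toStrongDual Λ x = y := tendsto_nhds_unique h1 h2
  rwa [h3]

/-- The set where uniformly bounded functionals converge to a given functional is closed, by
equicontinuity. -/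
theorem isClosed_setOf_tendsto_clm {E : Type*} [NormedAddCommGroup E] [NormedSpace ℝ E]
    {L : ℕ → E →L[ℝ] ℝ} {C : ℝ} (hL : ∀ k, ‖L k‖ ≤ C) (Λ : E →L[ℝ] ℝ) :
    IsClosed {x | Tendsto (fun k ↦ L k x) atTop (𝓝 (Λ x))} := by
  have hequi : UniformEquicontinuous fun k x ↦ L k x :=
    LipschitzWith.uniformEquicontinuous _ C.toNNReal fun k ↦
      (L k).lipschitz.weaken (NNReal.le_toNNReal_of_coe_le (hL k))
  exact isClosed_of_closure_subset fun x hx ↦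
    (hequi.equicontinuous x).tendsto_of_mem_closure (Λ.continuous.tendsto x |>.mono_left
      nhdsWithin_le_nhds) (fun y hy ↦ hy) hx

/-! ### Weak convergence in the sense of Hoffmann-Jørgensen -/

section HoffmannJorgensen

theorem outerExpectation_eq_integral {Ω : Type*} [MeasurableSpace Ω] {P : Measure Ω}
    {T : Ω → ℝ} (hT : Measurable T) (hTi : Integrable T P) :
    outerExpectation P T = ∫ ω, T ω ∂P := by
  refine IsLeast.csInf_eq ⟨⟨T, hT, hTi, fun _ ↦ le_rfl, rfl⟩, ?_⟩
  rintro r ⟨U, -, hU, hTU, rfl⟩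
  exact integral_mono hTi hU hTU

variable {S : Type*} {Ω : ℕ → Type*} [∀ n, MeasurableSpace (Ω n)] {P : ∀ n, Measure (Ω n)}
  {Ω' : Type*} [MeasurableSpace Ω'] {P' : Measure Ω'} {X : ∀ n, Ω n → S} {Z : Ω' → S}

theorem TendstoHoffmannJorgensen.measurable_comp [TopologicalSpace S]
    (h : TendstoHoffmannJorgensen X P Z P') {f : S → ℝ} (hf : Continuous f) :
    Measurable fun ω ↦ f (Z ω) := by
  borelize S
  exact hf.measurable.comp h.borel_measurable_limit

/-- A closed set containing all values of the `X n` contains almost all values of the limit: test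
the convergence against the truncated distance to the set. No separability of `S` is needed. -/
theorem TendstoHoffmannJorgensen.ae_mem_of_isClosed [PseudoMetricSpace S]
    [∀ n, IsProbabilityMeasure (P n)] [IsProbabilityMeasure P']
    (h : TendstoHoffmannJorgensen X P Z P') {A : Set S} (hA : IsClosed A)
    (hX : ∀ n ω, X n ω ∈ A) : ∀ᵐ ω ∂P', Z ω ∈ A := by
  have hne : A.Nonempty := by
    obtain ⟨ω⟩ := nonempty_of_isProbabilityMeasure (P 0)
    exact ⟨_, hX 0 ω⟩
  have hcont : Continuous fun x ↦ min (Metric.infDist x A) 1 := by fun_prop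
  have hb (x : S) : ‖min (Metric.infDist x A) 1‖ ≤ 1 := by
    rw [Real.norm_of_nonneg (le_min Metric.infDist_nonneg zero_le_one)]
    exact min_le_right _ _
  let H : S →ᵇ ℝ := BoundedContinuousFunction.ofNormedAddCommGroup _ hcont 1 hb
  have h0 : ∀ n, outerExpectation (P n) (fun ω ↦ H (X n ω)) = 0 := by
    intro n
    have : (fun ω ↦ H (X n ω)) = fun _ ↦ 0 := by
      ext ω
      simp [H, Metric.infDist_zero_of_mem (hX n ω)]
    rw [this, outerExpectation_eq_integral measurable_const (integrable_const _)]
    simp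
  have hlim := h.tendsto_outerExpectation H
  simp only [h0] at hlim
  have hint : ∫ ω, H (Z ω) ∂P' = 0 := (tendsto_nhds_unique hlim tendsto_const_nhds)
  have hHint : Integrable (fun ω ↦ H (Z ω)) P' :=
    Integrable.of_bound (h.measurable_comp H.continuous).aestronglyMeasurable 1
      (ae_of_all _ fun ω ↦ hb (Z ω))
  have hae : (fun ω ↦ H (Z ω)) =ᵐ[P'] 0 := (integral_eq_zero_iff_of_nonneg
    (fun ω ↦ show 0 ≤ H (Z ω) from le_min Metric.infDist_nonneg zero_le_one) hHint).1 hint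
  filter_upwards [hae] with ω hω
  rw [← hA.closure_eq, Metric.mem_closure_iff_infDist_zero hne]
  have h1 : min (Metric.infDist (Z ω) A) 1 = 0 := hω
  rcases min_choice (Metric.infDist (Z ω) A) 1 with h2 | h2 <;> linarith

/-- Continuous mapping theorem for a real-valued continuous `f` along which the `X n` become
genuine random variables. -/
theorem TendstoHoffmannJorgensen.tendstoInDistribution_comp [TopologicalSpace S]
    [∀ n, IsProbabilityMeasure (P n)] [IsProbabilityMeasure P']
    (h : TendstoHoffmannJorgensen X P Z P') {f : S → ℝ} (hf : Continuous f)
    (hX : ∀ n, Measurable fun ω ↦ f (X n ω)) :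
    TendstoInDistribution (fun n ω ↦ f (X n ω)) atTop (fun ω ↦ f (Z ω)) P P' where
  forall_aemeasurable n := (hX n).aemeasurable
  aemeasurable_limit := (h.measurable_comp hf).aemeasurable
  tendsto := by
    refine ProbabilityMeasure.tendsto_iff_forall_integral_tendsto.2 fun φ ↦ ?_
    have h1 := h.tendsto_outerExpectation (φ.compContinuous ⟨f, hf⟩)
    simp only [ProbabilityMeasure.coe_mk]
    rw [integral_map (h.measurable_comp hf).aemeasurable (by fun_prop)]
    refine h1.congr fun n ↦ ?_
    have hm : Measurable fun ω ↦ φ (f (X n ω)) := φ.continuous.measurable.comp (hX n)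
    rw [integral_map (hX n).aemeasurable (by fun_prop)]
    exact outerExpectation_eq_integral hm
      (Integrable.of_bound hm.aestronglyMeasurable ‖φ‖ (ae_of_all _ fun ω ↦ φ.norm_coe_le_norm _))

end HoffmannJorgensen

/-! ### Step functions on grids -/

/-- The points `-(k + 1), -(k + 1) + 1 / (k + 1), …` of the `k`-th grid, whose mesh is
`1 / (k + 1)`. -/
noncomputable def gridPoint (k i : ℕ) : ℝ := i / (k + 1) - (k + 1)

theorem gridPoint_monotone (k : ℕ) : Monotone (gridPoint k) := by
  intro i j hij
  simp only [gridPoint]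
  gcongr

theorem gridPoint_succ (k i : ℕ) : gridPoint k (i + 1) = gridPoint k i + 1 / (k + 1) := by
  simp only [gridPoint]; push_cast; ring

/-- The number of cells of the `k`-th grid needed to cover `(-(k + 1), k + 1]`. -/
def gridSize (k : ℕ) : ℕ := 2 * (k + 1) ^ 2

theorem gridPoint_zero (k : ℕ) : gridPoint k 0 = -(k + 1) := by simp [gridPoint]

theorem gridPoint_gridSize (k : ℕ) : gridPoint k (gridSize k) = k + 1 := by
  simp only [gridPoint, gridSize]; push_cast; field_simp; ring

/-- The step function equal on each cell `(a, b]` of the `k`-th grid to `g b`, and to `0` off the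
grid. Taking the value at the right end point makes it converge to `g` when `g` is
right-continuous. -/
noncomputable def gridStep (g : ℝ → ℝ) (k : ℕ) (x : ℝ) : ℝ :=
  ∑ i ∈ Finset.range (gridSize k),
    (Ioc (gridPoint k i) (gridPoint k (i + 1))).indicator (fun _ ↦ g (gridPoint k (i + 1))) x

theorem measurable_gridStep (g : ℝ → ℝ) (k : ℕ) : Measurable (gridStep g k) :=
  Finset.measurable_sum _ fun _ _ ↦ measurable_const.indicator measurableSet_Ioc

theorem gridStep_eq (g : ℝ → ℝ) {k i : ℕ} (hi : i < gridSize k) {x : ℝ}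
    (hx : x ∈ Ioc (gridPoint k i) (gridPoint k (i + 1))) :
    gridStep g k x = g (gridPoint k (i + 1)) := by
  rw [gridStep, Finset.sum_eq_single_of_mem i (Finset.mem_range.2 hi), indicator_of_mem hx]
  intro j _ hji
  refine indicator_of_notMem (fun hj ↦ ?_) _
  exact ((gridPoint_monotone k).pairwise_disjoint_on_Ioc_succ hji).le_bot ⟨hj, hx⟩

theorem exists_mem_Ioc_gridPoint {k : ℕ} {x : ℝ} (hx : x ∈ Ioc (-(k + 1 : ℝ)) (k + 1)) :
    ∃ i < gridSize k, x ∈ Ioc (gridPoint k i) (gridPoint k (i + 1)) := by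
  rw [← gridPoint_zero, ← gridPoint_gridSize,
    ← (gridPoint_monotone k).biUnion_Ico_Ioc_map_succ] at hx
  simpa [and_assoc, and_left_comm] using hx

theorem abs_gridStep_le {g : ℝ → ℝ} {C : ℝ} (hC : 0 ≤ C) (hg : ∀ x, |g x| ≤ C) (k : ℕ) (x : ℝ) :
    |gridStep g k x| ≤ C := by
  by_cases h : ∃ i < gridSize k, x ∈ Ioc (gridPoint k i) (gridPoint k (i + 1))
  · obtain ⟨i, hi, hx⟩ := h
    rw [gridStep_eq g hi hx]
    exact hg _
  · push Not at h
    rw [gridStep, Finset.sum_eq_zero fun i hi ↦ indicator_of_notMem (h i (Finset.mem_range.1 hi)) _]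
    simpa

theorem tendsto_gridStep {g : ℝ → ℝ} {x : ℝ} (hg : ContinuousWithinAt g (Ici x) x) :
    Tendsto (fun k ↦ gridStep g k x) atTop (𝓝 (g x)) := by
  have hex : ∀ᶠ k : ℕ in atTop, ∃ i < gridSize k,
      x ∈ Ioc (gridPoint k i) (gridPoint k (i + 1)) := by
    filter_upwards [eventually_ge_atTop ⌈|x|⌉₊] with k hk
    have h1 := (Nat.le_ceil |x|).trans (Nat.cast_le.2 hk)
    have h2 := abs_le.1 h1
    exact exists_mem_Ioc_gridPoint ⟨by linarith, by linarith⟩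
  have hex' : ∀ k : ℕ, ∃ y : ℝ, (∃ i < gridSize k,
      x ∈ Ioc (gridPoint k i) (gridPoint k (i + 1))) →
      x ≤ y ∧ y ≤ x + 1 / (k + 1) ∧ gridStep g k x = g y := by
    intro k
    by_cases h : ∃ i < gridSize k, x ∈ Ioc (gridPoint k i) (gridPoint k (i + 1))
    · obtain ⟨i, hi, hx⟩ := h
      refine ⟨gridPoint k (i + 1), fun _ ↦ ⟨hx.2, ?_, gridStep_eq g hi hx⟩⟩
      rw [gridPoint_succ]
      linarith [hx.1]
    · exact ⟨0, fun h' ↦ absurd h' h⟩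
  -- `y k` is the right end point of the cell containing `x`; it tends to `x` from the right.
  choose y hy using hex'
  have hyx : Tendsto y atTop (𝓝 x) := by
    have hu : Tendsto (fun k : ℕ ↦ x + 1 / ((k : ℝ) + 1)) atTop (𝓝 x) := by
      simpa using tendsto_one_div_add_atTop_nhds_zero_nat.const_add x
    refine tendsto_of_tendsto_of_tendsto_of_le_of_le' tendsto_const_nhds hu ?_ ?_
    · filter_upwards [hex] with k hk using (hy k hk).1
    · filter_upwards [hex] with k hk using (hy k hk).2.1
  have hyx' : Tendsto y atTop (𝓝[≥] x) :=
    tendsto_nhdsWithin_iff.2 ⟨hyx, by filter_upwards [hex] with k hk using (hy k hk).1⟩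
  refine (hg.tendsto.comp hyx').congr' ?_
  filter_upwards [hex] with k hk using (hy k hk).2.2.symm

theorem measurable_of_rightContinuous {g : ℝ → ℝ} (hg : ∀ x, ContinuousWithinAt g (Ici x) x) :
    Measurable g :=
  measurable_of_tendsto_metrizable (measurable_gridStep g)
    (tendsto_pi_nhds.2 fun x ↦ tendsto_gridStep (hg x))

/-! ### Riemann-Stieltjes sums -/

/-- The Riemann-Stieltjes sum `F ↦ ∑ g(a_{i+1}) (F(a_{i+1}) - F(a_i))` over the `k`-th grid, as a
continuous linear functional on bounded functions. -/
noncomputable def stieltjesSum (g : ℝ → ℝ) (k : ℕ) : ℓ^∞(ℝ, ℝ) →L[ℝ] ℝ :=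
  ∑ i ∈ Finset.range (gridSize k), g (gridPoint k (i + 1)) •
    (lp.evalCLM ℝ (fun _ : ℝ ↦ ℝ) ∞ (gridPoint k (i + 1)) -
      lp.evalCLM ℝ (fun _ : ℝ ↦ ℝ) ∞ (gridPoint k i))

theorem stieltjesSum_apply (g : ℝ → ℝ) (k : ℕ) (F : ℓ^∞(ℝ, ℝ)) :
    stieltjesSum g k F = ∑ i ∈ Finset.range (gridSize k), g (gridPoint k (i + 1)) *
      (F (gridPoint k (i + 1)) - F (gridPoint k i)) := by
  simp only [stieltjesSum, sum_apply, smul_apply, sub_apply, smul_eq_mul]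
  rfl

/-- Summation by parts, moving the increments from `F` to `g`. -/
theorem sum_mul_sub_eq_sub_sum_sub_mul (g F : ℕ → ℝ) (n : ℕ) :
    ∑ i ∈ Finset.range n, g (i + 1) * (F (i + 1) - F i) =
      g n * F n - g 0 * F 0 - ∑ i ∈ Finset.range n, (g (i + 1) - g i) * F i := by
  rw [eq_sub_iff_add_eq, ← Finset.sum_add_distrib, ← Finset.sum_range_sub (fun i ↦ g i * F i)]
  exact Finset.sum_congr rfl fun i _ ↦ by ring

theorem BoundedVariationOn.sum_abs_sub_le {g : ℝ → ℝ} (hg : BoundedVariationOn g univ) {u : ℕ → ℝ}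
    (hu : Monotone u) (n : ℕ) :
    ∑ i ∈ Finset.range n, |g (u (i + 1)) - g (u i)| ≤ (eVariationOn g univ).toReal := by
  have h := eVariationOn.sum_le (f := g) (s := univ) (n := n) hu fun _ ↦ mem_univ _
  rw [← ENNReal.ofReal_le_iff_le_toReal hg, ENNReal.ofReal_sum_of_nonneg fun _ _ ↦ abs_nonneg _]
  simpa only [edist_dist, Real.dist_eq] using h

/-- The Riemann-Stieltjes sums are bounded uniformly in the grid by the sup norm of `F`, because
summation by parts puts the variation on `g`. -/
theorem norm_stieltjesSum_le {g : ℝ → ℝ} (hg : BoundedVariationOn g univ) {C : ℝ}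
    (hC : ∀ x, |g x| ≤ C) (k : ℕ) :
    ‖stieltjesSum g k‖ ≤ 2 * C + (eVariationOn g univ).toReal := by
  have hC0 : 0 ≤ C := (abs_nonneg _).trans (hC 0)
  refine ContinuousLinearMap.opNorm_le_bound _ (by positivity) fun F ↦ ?_
  have hF (t : ℝ) : |F t| ≤ ‖F‖ := lp.norm_apply_le_norm ENNReal.top_ne_zero F t
  have hgF (t : ℝ) : |g t * F t| ≤ C * ‖F‖ := by
    rw [abs_mul]
    exact mul_le_mul (hC t) (hF t) (abs_nonneg _) hC0
  rw [stieltjesSum_apply, sum_mul_sub_eq_sub_sum_sub_mul (fun i ↦ g (gridPoint k i))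
    (fun i ↦ F (gridPoint k i)), Real.norm_eq_abs]
  have hsum : |∑ i ∈ Finset.range (gridSize k),
      (g (gridPoint k (i + 1)) - g (gridPoint k i)) * F (gridPoint k i)| ≤
      (eVariationOn g univ).toReal * ‖F‖ := by
    refine (Finset.abs_sum_le_sum_abs _ _).trans ?_
    refine le_trans ?_ (mul_le_mul_of_nonneg_right
      (hg.sum_abs_sub_le (gridPoint_monotone k) (gridSize k)) (norm_nonneg F))
    rw [Finset.sum_mul]
    gcongr with i _
    rw [abs_mul]
    exact mul_le_mul_of_nonneg_left (hF _) (abs_nonneg _)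
  refine (abs_sub _ _).trans ?_
  have := abs_sub (g (gridPoint k (gridSize k)) * F (gridPoint k (gridSize k)))
    (g (gridPoint k 0) * F (gridPoint k 0))
  have := hgF (gridPoint k (gridSize k))
  have := hgF (gridPoint k 0)
  linarith

/-! ### The Lebesgue-Stieltjes integral as a limit of sums -/

theorem isFiniteMeasure_variation {X : Type*} [MeasurableSpace X] (μ : SignedMeasure X) :
    IsFiniteMeasure μ.variation := by
  rw [← SignedMeasure.totalVariation_eq_variation]
  infer_instance

theorem integral_indicator_Ioc_const {F : ℝ → ℝ} (hF : BoundedVariationOn F univ)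
    (hFr : ∀ t, ContinuousWithinAt F (Ici t) t) {a b : ℝ} (hab : a ≤ b) (c : ℝ) :
    lebesgueStieltjesIntegral hF ((Ioc a b).indicator fun _ ↦ c) = c * (F b - F a) := by
  have hr (t : ℝ) : F.rightLim t = F t :=
    (hFr t).rightLim_eq
  have := isFiniteMeasure_variation (hF.vectorMeasure.restrict (Ioc a b))
  have hconst := VectorMeasure.integral_const (μ := hF.vectorMeasure.restrict (Ioc a b))
    (B := ContinuousLinearMap.lsmul ℝ ℝ) c
  rw [VectorMeasure.restrict_apply _ measurableSet_Ioc .univ, univ_inter,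
    hF.vectorMeasure_Ioc hab, hr, hr] at hconst
  exact (VectorMeasure.integral_indicator measurableSet_Ioc).trans hconst

theorem lebesgueStieltjesIntegral_gridStep {F : ℝ → ℝ} (hF : BoundedVariationOn F univ)
    (hFr : ∀ t, ContinuousWithinAt F (Ici t) t) (g : ℝ → ℝ) (k : ℕ) :
    lebesgueStieltjesIntegral hF (gridStep g k) =
      ∑ i ∈ Finset.range (gridSize k), g (gridPoint k (i + 1)) *
        (F (gridPoint k (i + 1)) - F (gridPoint k i)) := by
  simp_rw [← integral_indicator_Ioc_const hF hFr (gridPoint_monotone k (Nat.le_succ _))]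
  refine VectorMeasure.integral_finsetSum _ fun i _ ↦ ?_
  have := isFiniteMeasure_variation hF.vectorMeasure
  exact (integrable_const _).indicator measurableSet_Ioc

/-- The sums are the integrals of the step functions, so dominated convergence applies. -/
theorem tendsto_sum_lebesgueStieltjesIntegral {F : ℝ → ℝ} (hF : BoundedVariationOn F univ)
    (hFr : ∀ t, ContinuousWithinAt F (Ici t) t) {g : ℝ → ℝ}
    (hgr : ∀ t, ContinuousWithinAt g (Ici t) t) {C : ℝ} (hC : ∀ x, |g x| ≤ C) :
    Tendsto (fun k ↦ ∑ i ∈ Finset.range (gridSize k), g (gridPoint k (i + 1)) *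
        (F (gridPoint k (i + 1)) - F (gridPoint k i))) atTop
      (𝓝 (lebesgueStieltjesIntegral hF g)) := by
  simp_rw [← lebesgueStieltjesIntegral_gridStep hF hFr]
  have := isFiniteMeasure_variation hF.vectorMeasure
  exact VectorMeasure.tendsto_integral_of_dominated_convergence (fun _ ↦ C)
    (fun k ↦ (measurable_gridStep g k).aestronglyMeasurable) (integrable_const C)
    (fun k ↦ ae_of_all _ (abs_gridStep_le ((abs_nonneg _).trans (hC 0)) hC k))
    (ae_of_all _ fun x ↦ tendsto_gridStep (hgr x))

theorem BoundedVariationOn.exists_forall_abs_le {g : ℝ → ℝ} (hg : BoundedVariationOn g univ) :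
    ∃ C, ∀ x, |g x| ≤ C := by
  refine ⟨|g 0| + (eVariationOn g univ).toReal, fun x ↦ ?_⟩
  have h1 := hg.dist_le (mem_univ x) (mem_univ 0)
  have h2 := abs_sub_abs_le_abs_sub (g x) (g 0)
  rw [Real.dist_eq] at h1
  linarith

/-! ### Convergence of the integrals -/

theorem ProbabilityTheory.IsGaussianProcess.hasGaussianLaw_stieltjesSum {Ω : Type*}
    [MeasurableSpace Ω] {P : Measure Ω} {Z : Ω → ℓ^∞(ℝ, ℝ)}
    (hZ : IsGaussianProcess (fun t ω ↦ Z ω t) P) (g : ℝ → ℝ) (k : ℕ) :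
    HasGaussianLaw (fun ω ↦ stieltjesSum g k (Z ω)) P := by
  have h : IsGaussianProcess (fun i ω ↦ g (gridPoint k (i + 1)) *
      (Z ω (gridPoint k (i + 1)) - Z ω (gridPoint k i))) P := by
    refine hZ.of_isGaussianProcess fun i ↦ ⟨{gridPoint k (i + 1), gridPoint k i},
      g (gridPoint k (i + 1)) • (.proj ⟨gridPoint k (i + 1), by simp⟩ -
        .proj ⟨gridPoint k i, by simp⟩), fun ω ↦ by simp⟩
  simpa only [stieltjesSum_apply] using h.hasGaussianLaw_fun_sum (I := Finset.range (gridSize k))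

theorem lemma9 {Ω : ℕ → Type*} [∀ n, MeasurableSpace (Ω n)]
    (P : ∀ n, Measure (Ω n)) [∀ n, IsProbabilityMeasure (P n)]
    {Ω' : Type*} [MeasurableSpace Ω'] (P' : Measure Ω') [IsProbabilityMeasure P']
    -- the processes, with bounded sample paths
    (Z : ∀ n, Ω n → ℓ^∞(ℝ, ℝ))
    (hZ_meas : ∀ n t, Measurable (fun ω ↦ Z n ω t))
    -- sample paths vanish at infinity, are right-continuous and of bounded variation
    (hZ_lim : ∀ n ω, Tendsto (fun t ↦ Z n ω t) (cocompact ℝ) (𝓝 0))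
    (hZ_right : ∀ n ω t, ContinuousWithinAt (fun t ↦ Z n ω t) (Ici t) t)
    (hZ_bv : ∀ n ω, BoundedVariationOn (fun t ↦ Z n ω t) univ)
    -- weak convergence to a Gaussian process
    (Zlim : Ω' → ℓ^∞(ℝ, ℝ))
    (hZlim : IsGaussianProcess (fun t ω ↦ Zlim ω t) P')
    (hconv : TendstoHoffmannJorgensen Z P Zlim P')
    -- a right-continuous integrand of bounded variation
    (g : ℝ → ℝ) (hg_right : ∀ t, ContinuousWithinAt g (Ici t) t)
    (hg_bv : BoundedVariationOn g univ) :
    (∀ n ω, (hZ_bv n ω).vectorMeasure.Integrable g) ∧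
    (∀ n, Measurable (fun ω ↦ lebesgueStieltjesIntegral (hZ_bv n ω) g)) ∧
    ∃ (m : ℝ) (v : NNReal),
      TendstoInDistribution (fun n ω ↦ lebesgueStieltjesIntegral (hZ_bv n ω) g) atTop
        (id : ℝ → ℝ) P (gaussianReal m v) := by
  obtain ⟨C, hC⟩ := hg_bv.exists_forall_abs_le
  have hL := norm_stieltjesSum_le hg_bv hC
  obtain ⟨Λ, hΛ⟩ := exists_clm_tendsto_of_bounded hL
  have hsum (n : ℕ) (ω : Ω n) : Tendsto (fun k ↦ stieltjesSum g k (Z n ω)) atTop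
      (𝓝 (lebesgueStieltjesIntegral (hZ_bv n ω) g)) := by
    simpa only [stieltjesSum_apply] using
      tendsto_sum_lebesgueStieltjesIntegral (hZ_bv n ω) (hZ_right n ω) hg_right hC
  have hΛZ (n : ℕ) (ω : Ω n) : lebesgueStieltjesIntegral (hZ_bv n ω) g = Λ (Z n ω) :=
    tendsto_nhds_unique (hsum n ω) (hΛ _ _ (hsum n ω))
  have hmeas (n : ℕ) : Measurable fun ω ↦ lebesgueStieltjesIntegral (hZ_bv n ω) g := by
    refine measurable_of_tendsto_metrizable (fun k ↦ ?_) (tendsto_pi_nhds.2 (hsum n))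
    simp only [stieltjesSum_apply]
    have hZn (t : ℝ) : Measurable (β := ℝ) fun ω ↦ Z n ω t := hZ_meas n t
    exact Finset.measurable_sum _ fun i _ ↦ ((hZn _).sub (hZn _)).const_mul _
  have hlim : ∀ᵐ ω ∂P', Tendsto (fun k ↦ stieltjesSum g k (Zlim ω)) atTop (𝓝 (Λ (Zlim ω))) :=
    hconv.ae_mem_of_isClosed (isClosed_setOf_tendsto_clm hL Λ) fun n ω ↦ hΛ _ _ (hsum n ω)
  obtain ⟨m, v, hmv⟩ := exists_map_eq_gaussianReal_of_tendsto_ae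
    (hZlim.hasGaussianLaw_stieltjesSum g) (hconv.measurable_comp Λ.continuous).aemeasurable hlim
  refine ⟨fun n ω ↦ ?_, hmeas, m, v, ?_⟩
  · have := isFiniteMeasure_variation (hZ_bv n ω).vectorMeasure
    exact Integrable.of_bound (measurable_of_rightContinuous hg_right).aestronglyMeasurable C
      (ae_of_all _ hC)
  · have hdist := hconv.tendstoInDistribution_comp Λ.continuous
      fun n ↦ by simpa only [hΛZ] using hmeas n
    simp only [hΛZ]
    refine ⟨hdist.forall_aemeasurable, aemeasurable_id, ?_⟩
    convert hdist.tendsto using 1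
    exact congrArg 𝓝 (Subtype.ext (Measure.map_id.trans hmv.symm))
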